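/- Let $B$ be a standard Brownian motion, $\sigma>0$, and let $\mu:(0,\infty)\to(0,\infty)$ be strictly decreasing and continuous with $\lim_{a\to0^+}\mu(a)=\infty$; put $\mu(0):=\infty$ and $\mu(\infty):=\lim_{a\to\infty}\mu(a)\ge 0$. For $t\ge0$ let $X_t(0)=0$ and $X_t(a)=\sigma B_t-\mu(a)t$ for $a\in(0,\infty]$, and let $M_*(a)=\sup_{t\ge0}X_t(a)$ for $a\in[0,\infty]$. Let $w:[0,\infty)\to[0,\infty)$ be a continuous, nondecreasing stochastic process that is independent of $B$, with $w(0)=0$, $\mathbb{E}\big[\int_0^1 w(a)a^{-2}\,da\big]<\infty$ and $\mathbb{E}[w(\infty)]<\infty$, where $w(\infty):=\lim_{a\to\infty}w(a)$. For $a\in[0,\infty]$ and $t\ge0$ let $\chi_t(a)=w(a)+X_t(a)$ and $$W_t^w(a)=\chi_t(a)-\Big(\inf_{0\le s\le t}\chi_s(a)\Big)\wedge 0 ,\qquad Z_t^w=\int_0^\infty\frac{W_t^w(x)}{x^2}\,dx,\qquad Z_*=\int_0^\infty\frac{M_*(x)}{x^2}\,dx .$$ Let $\gamma\ge1$. (i)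 For every $a\in[0,\infty]$ with $\mu(a)>0$ and $\mathbb{E}[(w(a))^\gamma]<\infty$, the moments $\mathbb{E}[(W_t^w(a))^\gamma]$, $t\ge0$, and $\mathbb{E}[(M_*(a))^\gamma]$ are finite and $\lim_{t\to\infty}\mathbb{E}[(W_t^w(a))^\gamma]=\mathbb{E}[(M_*(a))^\gamma]$. (ii) If $\int_0^\infty\frac{1}{x^2\mu(x)}\,dx<\infty$, then $\mathbb{E}[Z_t^w]$, $t\ge0$, and $\mathbb{E}[Z_*]$ are finite and $\lim_{t\to\infty}\mathbb{E}[Z_t^w]=\mathbb{E}[Z_*]$. Furthermore, if $\gamma>1$, $\mathbb{E}[(Z_0^w)^\gamma]<\infty$, $$\int_0^1\frac{1}{x^{2\gamma}\mu(x)^\gamma}\,dx<\infty\quad\text{and}\quad\int_1^\infty\frac{1}{x^{\gamma}\mu(x)^\gamma}\,dx<\infty,$$ then $\mathbb{E}[(Z_t^w)^\gamma]$, $t\ge0$, and $\mathbb{E}[(Z_*)^\gamma]$ are finite and $\lim_{t\to\infty}\mathbb{E}[(Z_t^w)^\gamma]=\mathbb{E}[(Z_*)^\gamma]$. -/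

import Mathlib

open MeasureTheory ProbabilityTheory Filter Topology
open scoped NNReal ENNReal

namespace RCBM

noncomputable section

/-- `μ : (0,∞) → (0,∞)` is a drift function: strictly decreasing, continuous, with `μ(0+) = ∞`.
Only the values of `μ` on `(0,∞)` are used. -/
structure IsDrift (μ : ℝ → ℝ) : Prop where
  pos : ∀ a, 0 < a → 0 < μ a
  strictAnti : StrictAntiOn μ (Set.Ioi 0)
  continuousOn : ContinuousOn μ (Set.Ioi 0)
  tendsto_zero : Tendsto μ (𝓝[>] 0) atTop

/-- The drift function extended to `[0,∞]`: `μ(∞) = lim_{b → ∞} μ(b)` and `μ(0) = μ(0+) = ∞`. -/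
def driftExt (μ : ℝ → ℝ) (a : ℝ≥0∞) : ℝ≥0∞ :=
  if a = ∞ then limUnder atTop (fun b : ℝ => ENNReal.ofReal (μ b))
  else if a = 0 then ∞
  else ENNReal.ofReal (μ a.toReal)

variable {Ω : Type*}

/-- A nonnegative process `w` on `[0,∞)` extended to `[0,∞]` by `w(∞) = lim_{b → ∞} w(b)`. -/
def initExt (w : ℝ≥0 → Ω → ℝ≥0) (a : ℝ≥0∞) (ω : Ω) : ℝ≥0∞ :=
  if a = ∞ then limUnder atTop (fun b : ℝ≥0 => (w b ω : ℝ≥0∞))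
  else (w a.toNNReal ω : ℝ≥0∞)

/-- The set of finite initial conditions: continuous nondecreasing nonnegative processes `w`,
independent of `B`, with `w(0) = 0`, `E[∫₀¹ w(a)/a² da] < ∞` and `E[w(∞)] < ∞`. -/
structure IsInitial [MeasurableSpace Ω] (P : Measure Ω) (B : ℝ≥0 → Ω → ℝ)
    (w : ℝ≥0 → Ω → ℝ≥0) : Prop where
  measurable : ∀ a, Measurable (w a)
  continuous : ∀ᵐ ω ∂P, Continuous (fun a => w a ω)
  monotone : ∀ᵐ ω ∂P, Monotone (fun a => w a ω)
  zero : ∀ᵐ ω ∂P, w 0 ω = 0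
  indep : IndepFun (fun ω a => w a ω) (fun ω t => B t ω) P
  integral_lt_top :
    ∫⁻ ω, (∫⁻ a in Set.Ioc (0 : ℝ) 1, (w a.toNNReal ω : ℝ≥0∞) / ENNReal.ofReal (a ^ 2)) ∂P < ∞
  top_lt_top : ∫⁻ ω, initExt w ∞ ω ∂P < ∞

/-- Coupled Brownian motions starting from zero: `X_t(0) = 0` and `X_t(a) = σ B_t - μ(a) t`
for `a ∈ (0,∞]`. -/
def X (σ : ℝ) (μ : ℝ → ℝ) (B : ℝ≥0 → Ω → ℝ) (t : ℝ≥0) (a : ℝ≥0∞) (ω : Ω) : ℝ :=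
  if a = 0 then 0 else σ * B t ω - (driftExt μ a).toReal * t

/-- The maximum process `M_*(a) = sup_{t ≥ 0} X_t(a)`, with values in `[0,∞]`. Taking positive
parts changes nothing where `X_0(a) = 0`, which holds almost surely. -/
def Mstar (σ : ℝ) (μ : ℝ → ℝ) (B : ℝ≥0 → Ω → ℝ) (a : ℝ≥0∞) (ω : Ω) : ℝ≥0∞ :=
  ⨆ t : ℝ≥0, ENNReal.ofReal (X σ μ B t a ω)

/-- The one-dimensional Skorokhod map `Ψ[f](t) = f(t) - (inf_{0 ≤ s ≤ t} f(s)) ∧ 0`. -/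
def skorokhod (f : ℝ≥0 → ℝ) (t : ℝ≥0) : ℝ :=
  f t - min (sInf (f '' Set.Icc 0 t)) 0

/-- `χ_t(a) = w(a) + X_t(a)`. -/
def chi (σ : ℝ) (μ : ℝ → ℝ) (B : ℝ≥0 → Ω → ℝ) (w : ℝ≥0 → Ω → ℝ≥0)
    (t : ℝ≥0) (a : ℝ≥0∞) (ω : Ω) : ℝ :=
  (initExt w a ω).toReal + X σ μ B t a ω

/-- Reflecting coupled Brownian motions `W_t(a) = Ψ[χ_·(a)](t)`, `a ∈ [0,∞]`. -/
def W (σ : ℝ) (μ : ℝ → ℝ) (B : ℝ≥0 → Ω → ℝ) (w : ℝ≥0 → Ω → ℝ≥0)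
    (t : ℝ≥0) (a : ℝ≥0∞) (ω : Ω) : ℝ :=
  skorokhod (fun s => chi σ μ B w s a ω) t

/-- `Z_t = ∫₀^∞ W_t(x)/x² dx`, with values in `[0,∞]`. -/
def Z (σ : ℝ) (μ : ℝ → ℝ) (B : ℝ≥0 → Ω → ℝ) (w : ℝ≥0 → Ω → ℝ≥0)
    (t : ℝ≥0) (ω : Ω) : ℝ≥0∞ :=
  ∫⁻ x in Set.Ioi (0 : ℝ),
    ENNReal.ofReal (W σ μ B w t (ENNReal.ofReal x) ω) / ENNReal.ofReal (x ^ 2)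

/-- `Z_* = ∫₀^∞ M_*(x)/x² dx`, with values in `[0,∞]`. -/
def Zstar (σ : ℝ) (μ : ℝ → ℝ) (B : ℝ≥0 → Ω → ℝ) (ω : Ω) : ℝ≥0∞ :=
  ∫⁻ x in Set.Ioi (0 : ℝ), Mstar σ μ B (ENNReal.ofReal x) ω / ENNReal.ofReal (x ^ 2)

end

end RCBM

namespace RCBM

/-! Write f(s) = u + σB_s − cs. The reflected path at time t is the maximum of sup_{s ≤ t} (f(t) −
f(t−s)) and f(t), up to positive parts (`ofReal_skorokhod_eq`). In the first term u cancels, and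
what remains is the running supremum, with drift −c, of the Brownian motion reversed from t. The
reversal does not involve c, so a single reversed Brownian motion serves all drifts at once, and
integrals of these suprema over the drifts have the same moments as for B itself
(`lintegral_runSup_reversePath`). For B the running suprema increase to the all-time suprema, so
these moments converge as soon as the limit is finite. The second term is dominated by u plus the
all-time supremum and vanishes eventually, so it tends to 0 in L^γ. Minkowski's inequality squeezes
the reflected process between the two (`tendsto_lintegral_rpow_of_le_of_le_add`).

`tendsto_lintegral_reflected_rpow` carries this out for an arbitrary s-finite measure on the drifts:
a Dirac mass gives W, and x⁻² dx gives Z. It remains to show that the limit has finite moments.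
Doob's inequality for the exponential martingale gives the tail exp(−2cy/σ²), hence γ-th moments of
order c^(−γ) (`lintegral_totSup_rpow_le`); Tonelli for the first moment, Hölder for higher ones,
turn the integrability assumptions on μ into a moment bound for Z_*. -/

/-- The positive part of the drifted path `σ b - c · id` at time `s`. -/
noncomputable def drifted (σ c : ℝ) (b : ℝ≥0 → ℝ) (s : ℝ≥0) : ℝ≥0∞ := ENNReal.ofReal (σ * b s - c * s)

/-- The running supremum up to time `t` of the positive part of the drifted path. -/
noncomputable def runSup (σ c : ℝ) (b : ℝ≥0 → ℝ) (t : ℝ≥0) : ℝ≥0∞ :=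
  ⨆ r : ℝ≥0, drifted σ c b (min r t)

/-- The all-time supremum of the positive part of the drifted path. -/
noncomputable def totSup (σ c : ℝ) (b : ℝ≥0 → ℝ) : ℝ≥0∞ := ⨆ r : ℝ≥0, drifted σ c b r

/-! ### Exponential tail and moments of the all-time supremum. -/

section Tail

variable {Ω : Type*} [MeasurableSpace Ω] {P : Measure Ω}
  {B : ℝ≥0 → Ω → ℝ}

lemma integrable_exp_gaussian {X : Ω → ℝ} {v : ℝ≥0} (hX : HasLaw X (gaussianReal 0 v) P) (θ : ℝ) :
    Integrable (fun ω => Real.exp (θ * X ω)) P := by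
  have h := integrable_exp_mul_gaussianReal (μ := 0) (v := v) θ
  rw [← hX.map_eq] at h
  exact (integrable_map_measure (by fun_prop) hX.aemeasurable).1 h

lemma integral_exp_gaussian {X : Ω → ℝ} {v : ℝ≥0} (hX : HasLaw X (gaussianReal 0 v) P) (θ : ℝ) :
    ∫ ω, Real.exp (θ * X ω) ∂P = Real.exp (θ ^ 2 / 2 * v) := by
  have h := mgf_gaussianReal hX.map_eq θ
  rw [mgf] at h
  rw [h]; congr 1; ring

lemma hasLaw_increment (hB : IsPreBrownianReal B P) (s δ : ℝ≥0) :
    HasLaw (fun ω => B (s + δ) ω - B s ω) (gaussianReal 0 δ) P := by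
  simpa using (hB.shift s).hasLaw_eval δ

variable [IsProbabilityMeasure P]

/-- The exponential martingale of a Brownian motion, sampled on a grid. -/
lemma martingale_exp_grid (hm : ∀ t, Measurable (B t)) (hB : IsPreBrownianReal B P) (θ : ℝ)
    (δ : ℝ≥0) :
    Martingale (fun (k : ℕ) ω => Real.exp (θ * B (k * δ) ω - θ ^ 2 / 2 * (k * δ)))
      (Filtration.natural (fun (k : ℕ) ω => B (k * δ) ω) fun _ => (hm _).stronglyMeasurable) P := by
  have hsm : ∀ k : ℕ, StronglyMeasurable (fun ω => B (k * δ) ω) := fun _ => (hm _).stronglyMeasurable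
  have hint : ∀ k : ℕ, Integrable
      (fun ω => Real.exp (θ * B (k * δ) ω - θ ^ 2 / 2 * (k * δ))) P := fun k => by
    simp_rw [sub_eq_add_neg, Real.exp_add]
    exact (integrable_exp_gaussian (hB.hasLaw_eval (k * δ)) θ).mul_const _
  have hadp : StronglyAdapted (Filtration.natural (fun (k : ℕ) ω => B (k * δ) ω) hsm)
      (fun (k : ℕ) ω => Real.exp (θ * B (k * δ) ω - θ ^ 2 / 2 * (k * δ))) := fun k => by
    have h := Filtration.stronglyAdapted_natural hsm k
    exact (Real.continuous_exp.comp (by fun_prop :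
      Continuous fun x : ℝ => θ * x - θ ^ 2 / 2 * (k * δ))).comp_stronglyMeasurable h
  refine martingale_nat hadp hint fun k => ?_
  set 𝓕 := Filtration.natural (fun (k : ℕ) ω => B (k * δ) ω) hsm
  set ξ : Ω → ℝ := fun ω => Real.exp (θ * (B (k * δ + δ) ω - B (k * δ) ω) - θ ^ 2 / 2 * δ) with hξ
  have hstep : (fun ω => Real.exp (θ * B ((k + 1 : ℕ) * δ) ω - θ ^ 2 / 2 * ((k + 1 : ℕ) * δ)))
      = (fun ω => Real.exp (θ * B (k * δ) ω - θ ^ 2 / 2 * (k * δ))) * ξ := by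
    funext ω
    simp only [Pi.mul_apply, hξ, ← Real.exp_add]
    have : ((k + 1 : ℕ) : ℝ≥0) * δ = k * δ + δ := by push_cast; ring
    rw [this]; congr 1; push_cast; ring
  have hξint : Integrable ξ P := by
    simp_rw [hξ, sub_eq_add_neg (θ * _), Real.exp_add]
    exact (integrable_exp_gaussian (hasLaw_increment hB (k * δ) δ) θ).mul_const _
  have hξone : ∫ ω, ξ ω ∂P = 1 := by
    simp_rw [hξ, sub_eq_add_neg (θ * _), Real.exp_add]
    rw [integral_mul_const, integral_exp_gaussian (hasLaw_increment hB (k * δ) δ) θ,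
      ← Real.exp_add, add_neg_cancel, Real.exp_zero]
  -- The increment is independent of the whole path up to time kδ, and the grid filtration sees only
  -- some of its coordinates.
  have hind : Indep (MeasurableSpace.comap (fun ω => B (k * δ + δ) ω - B (k * δ) ω) inferInstance)
      (𝓕 k) P := by
    have h := hB.indepFun_shift (k * δ)
    have hφ : Measurable fun f : ℝ≥0 → ℝ => f δ := measurable_pi_apply δ
    have h1 := h.comp hφ measurable_id
    refine indep_of_indep_of_le_right h1 ?_
    refine iSup₂_le fun j hj => ?_
    rw [← measurable_iff_comap_le]
    have hle : (j : ℝ≥0) * δ ≤ k * δ := by gcongr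
    have hψ : Measurable fun f : Set.Iic ((k : ℝ≥0) * δ) → ℝ => f ⟨(j : ℝ≥0) * δ, hle⟩ :=
      measurable_pi_apply _
    exact hψ.comp (comap_measurable _)
  have hcond : P[ξ | 𝓕 k] =ᵐ[P] fun _ => P[ξ] := by
    refine condExp_indep_eq ((hm _).sub (hm _)).comap_le (𝓕.le k) ?_ hind
    exact (Real.continuous_exp.comp (by fun_prop :
      Continuous fun x : ℝ => θ * x - θ ^ 2 / 2 * δ)).comp_stronglyMeasurable
        (comap_measurable _).stronglyMeasurable
  have hpull := condExp_mul_of_stronglyMeasurable_left (hadp k) (by rw [← hstep]; exact hint (k + 1))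
    hξint
  rw [hstep]
  filter_upwards [hpull, hcond] with ω h1 h2
  rw [h1, Pi.mul_apply, h2, hξone, mul_one]

/-- Doob's maximal inequality for the exponential martingale. The bound does not depend on the mesh
δ, which allows refining the grid. -/
lemma measure_exists_grid_le (hm : ∀ t, Measurable (B t)) (hB : IsPreBrownianReal B P) {σ c : ℝ}
    (hσ : 0 < σ) (hc : 0 < c) (δ : ℝ≥0) (y : ℝ) :
    P {ω | ∃ k : ℕ, y ≤ σ * B (k * δ) ω - c * (k * δ : ℝ≥0)} ≤
      ENNReal.ofReal (Real.exp (-(2 * c / σ ^ 2 * y))) := by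
  have hU : {ω | ∃ k : ℕ, y ≤ σ * B (k * δ) ω - c * (k * δ : ℝ≥0)} =
      ⋃ n : ℕ, {ω | ∃ k ≤ n, y ≤ σ * B (k * δ) ω - c * (k * δ : ℝ≥0)} := by
    ext ω; simp only [Set.mem_ofPred_eq, Set.mem_iUnion]
    exact ⟨fun ⟨k, hk⟩ => ⟨k, k, le_rfl, hk⟩, fun ⟨_, k, _, hk⟩ => ⟨k, hk⟩⟩
  rw [hU, Monotone.measure_iUnion]
  swap
  · intro n m hnm ω ⟨k, hk, h⟩
    exact ⟨k, hk.trans hnm, h⟩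
  refine iSup_le fun n => ?_
  -- This θ makes the exponent θB − θ²t/2 equal to (2c/σ²)(σB − ct), a multiple of the drifted path.
  set θ := 2 * c / σ
  have hmart := martingale_exp_grid hm hB θ δ
  set f := fun (k : ℕ) ω => Real.exp (θ * B (k * δ) ω - θ ^ 2 / 2 * (k * δ)) with hf
  set ε : ℝ≥0 := ⟨Real.exp (2 * c / σ ^ 2 * y), (Real.exp_pos _).le⟩ with hε
  have hmax := maximal_ineq hmart.submartingale (fun k ω => (Real.exp_pos _).le) (ε := ε) n
  have hE : ∫ ω, f n ω ∂P = 1 := by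
    have h0 : ∫ ω, f n ω ∂P = ∫ ω, f 0 ω ∂P := by
      have h := hmart.setIntegral_eq (Nat.zero_le n) MeasurableSet.univ
      simpa using h.symm
    rw [h0]
    have : f 0 =ᵐ[P] fun _ => 1 := by
      filter_upwards [hB.eval_zero_ae_eq_zero] with ω hω
      simp [hf, hω]
    rw [integral_congr_ae this]; simp
  have hle : ENNReal.ofReal (∫ ω in {ω | (ε : ℝ) ≤ (Finset.range (n + 1)).sup'
      Finset.nonempty_range_add_one fun k => f k ω}, f n ω ∂P) ≤ 1 := by
    rw [← ENNReal.ofReal_one, ← hE]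
    exact ENNReal.ofReal_le_ofReal (setIntegral_le_integral (hmart.integrable n)
      (Eventually.of_forall fun ω => (Real.exp_pos _).le))
  have hsub : {ω | ∃ k ≤ n, y ≤ σ * B (k * δ) ω - c * (k * δ : ℝ≥0)} ⊆
      {ω | (ε : ℝ) ≤ (Finset.range (n + 1)).sup' Finset.nonempty_range_add_one fun k => f k ω} := by
    rintro ω ⟨k, hk, h⟩
    rw [Set.mem_ofPred_eq]
    refine Finset.le_sup'_of_le (fun k => f k ω) (Finset.mem_range.2 (by omega : k < n + 1)) ?_
    simp only [hε, hf]
    refine Real.exp_le_exp.2 ?_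
    have e : θ * B (k * δ) ω - θ ^ 2 / 2 * (k * δ) =
        2 * c / σ ^ 2 * (σ * B (k * δ) ω - c * (k * δ : ℝ≥0)) := by
      simp only [θ]; push_cast; field_simp
    rw [e]
    gcongr
  have hεpos : (ε : ℝ≥0∞) ≠ 0 := by
    simp only [ne_eq, ENNReal.coe_eq_zero]
    exact fun h => (Real.exp_pos (2 * c / σ ^ 2 * y)).ne' (congrArg NNReal.toReal h)
  have hinv : ENNReal.ofReal (Real.exp (-(2 * c / σ ^ 2 * y))) = (ε : ℝ≥0∞)⁻¹ := by
    rw [Real.exp_neg, ENNReal.ofReal_inv_of_pos (Real.exp_pos _)]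
    congr 1
    rw [ENNReal.ofReal, hε]
    congr 1
    exact Real.toNNReal_of_nonneg _
  rw [hinv, ENNReal.le_inv_iff_mul_le, mul_comm]
  exact (mul_le_mul_right (measure_mono hsub) _).trans (hmax.trans hle)

/-- By continuity, a path exceeding y somewhere exceeds it on every sufficiently fine grid, at the
grid point just below the exceedance time. The grids are not nested, so the event is placed in the
limit inferior of the grid events, an increasing union. -/
lemma measure_totSup_gt_le (hm : ∀ t, Measurable (B t)) (hB : IsPreBrownianReal B P)
    (hc' : ∀ ω, Continuous fun t => B t ω) {σ c : ℝ}
    (hσ : 0 < σ) (hc : 0 < c) (y : ℝ) :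
    P {ω | ENNReal.ofReal y < totSup σ c fun t => B t ω} ≤
      ENNReal.ofReal (Real.exp (-(2 * c / σ ^ 2 * y))) := by
  set A : ℕ → Set Ω := fun N =>
    {ω | ∃ k : ℕ, y ≤ σ * B (k * (1 / (N + 1))) ω - c * (k * (1 / (N + 1)) : ℝ≥0)}
  have hsub : {ω | ENNReal.ofReal y < totSup σ c fun t => B t ω} ⊆ ⋃ N, ⋂ M ≥ N, A M := by
    intro ω hω
    obtain ⟨r, hr⟩ := lt_iSup_iff.1 (Set.mem_ofPred_eq ▸ hω : ENNReal.ofReal y < totSup σ c _)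
    have hr' : y < σ * B r ω - c * r := (ENNReal.ofReal_lt_ofReal_iff'.1 hr).1
    have hlim : Tendsto (fun N : ℕ => ((⌊(r : ℝ) * ((N + 1 : ℕ) : ℝ)⌋₊ : ℝ≥0) * (1 / ((N : ℝ≥0) + 1))))
        atTop (𝓝 r) := by
      have h1 := (tendsto_nat_floor_mul_div_atTop (R := ℝ) r.2).comp
        ((tendsto_natCast_atTop_atTop (R := ℝ)).comp (tendsto_add_atTop_nat 1))
      refine NNReal.tendsto_coe.1 (h1.congr fun N => ?_)
      simp [div_eq_mul_inv]
    have hcont : Continuous fun t : ℝ≥0 => σ * B t ω - c * t := by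
      have := hc' ω; fun_prop
    have hev := (hcont.tendsto r).comp hlim |>.eventually (lt_mem_nhds hr')
    obtain ⟨N, hN⟩ := eventually_atTop.1 hev
    refine Set.mem_iUnion.2 ⟨N, Set.mem_iInter₂.2 fun M hM => ⟨_, (hN M hM).le⟩⟩
  refine (measure_mono hsub).trans ?_
  rw [Monotone.measure_iUnion]
  swap
  · exact fun n m hnm => Set.biInter_mono (fun M (hM : M ≥ m) => hnm.trans hM) fun _ _ => le_rfl
  refine iSup_le fun N => (measure_mono (Set.biInter_subset_of_mem (Set.mem_ofPred_eq ▸ le_rfl :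
    N ∈ {M | M ≥ N}))).trans ?_
  exact measure_exists_grid_le hm hB hσ hc _ y

lemma ae_totSup_lt_top (hm : ∀ t, Measurable (B t)) (hB : IsPreBrownianReal B P)
    (hc' : ∀ ω, Continuous fun t => B t ω) {σ c : ℝ} (hσ : 0 < σ) (hc : 0 < c) :
    ∀ᵐ ω ∂P, totSup σ c (fun t => B t ω) < ∞ := by
  rw [ae_iff, ← nonpos_iff_eq_zero]
  have hlim : Tendsto (fun n : ℕ => ENNReal.ofReal (Real.exp (-(2 * c / σ ^ 2 * n)))) atTop
      (𝓝 0) := by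
    rw [← ENNReal.ofReal_zero]
    refine ENNReal.tendsto_ofReal (Real.tendsto_exp_neg_atTop_nhds_zero.comp ?_)
    exact tendsto_natCast_atTop_atTop.const_mul_atTop (by positivity)
  refine ge_of_tendsto' hlim fun n => ?_
  refine (measure_mono fun ω hω => ?_).trans (measure_totSup_gt_le hm hB hc' hσ hc n)
  simp only [not_lt, top_le_iff, Set.mem_ofPred_eq] at hω ⊢
  rw [hω]; exact ENNReal.ofReal_lt_top

/-- The all-time supremum of a Brownian motion with drift `-c` has moments of order `c ^ (-γ)`. -/
lemma lintegral_totSup_rpow_le (hm : ∀ t, Measurable (B t)) (hB : IsPreBrownianReal B P)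
    (hc' : ∀ ω, Continuous fun t => B t ω) {σ c : ℝ} (hσ : 0 < σ) (hc : 0 < c)
    (hmeas : Measurable fun ω => totSup σ c fun t => B t ω) {γ : ℝ} (hγ : 0 < γ) :
    ∫⁻ ω, (totSup σ c fun t => B t ω) ^ γ ∂P ≤
      ENNReal.ofReal (γ * (σ ^ 2 / 2) ^ γ * Real.Gamma γ * (1 / c) ^ γ) := by
  set θ := 2 * c / σ ^ 2 with hθ
  have hθ0 : 0 < θ := by positivity
  have h1 : ∫⁻ ω, (totSup σ c fun t => B t ω) ^ γ ∂P =
      ∫⁻ ω, ENNReal.ofReal ((totSup σ c fun t => B t ω).toReal ^ γ) ∂P := by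
    refine lintegral_congr_ae ?_
    filter_upwards [ae_totSup_lt_top hm hB hc' hσ hc] with ω hω
    rw [← ENNReal.ofReal_rpow_of_nonneg ENNReal.toReal_nonneg hγ.le, ENNReal.ofReal_toReal hω.ne]
  -- Layer cake formula; with the exponential tail it leaves a Gamma integral.
  rw [h1, lintegral_rpow_eq_lintegral_meas_lt_mul P (Eventually.of_forall fun _ =>
    ENNReal.toReal_nonneg) hmeas.ennreal_toReal.aemeasurable hγ]
  have hint : IntegrableOn (fun t : ℝ => t ^ (γ - 1) * Real.exp (-(θ * t))) (Set.Ioi 0) := by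
    refine Integrable.of_integral_ne_zero ?_
    rw [Real.integral_rpow_mul_exp_neg_mul_Ioi hγ hθ0]
    have := Real.Gamma_pos_of_pos hγ
    positivity
  calc ENNReal.ofReal γ * ∫⁻ t in Set.Ioi 0,
        P {ω | t < (totSup σ c fun t => B t ω).toReal} * ENNReal.ofReal (t ^ (γ - 1))
      ≤ ENNReal.ofReal γ * ∫⁻ t in Set.Ioi (0 : ℝ),
        ENNReal.ofReal (t ^ (γ - 1) * Real.exp (-(θ * t))) := by
        refine mul_le_mul' le_rfl (setLIntegral_mono' measurableSet_Ioi fun t ht => ?_)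
        rw [ENNReal.ofReal_mul (Real.rpow_nonneg (le_of_lt ht) _), mul_comm]
        gcongr
        refine (measure_mono fun ω hω => ?_).trans (measure_totSup_gt_le hm hB hc' hσ hc t)
        -- An infinite supremum has `toReal` equal to 0, which cannot exceed t > 0.
        exact ENNReal.ofReal_lt_iff_lt_toReal (le_of_lt ht)
          (fun h => by
            rw [Set.mem_ofPred_eq, h, ENNReal.toReal_top] at hω
            exact absurd hω (not_lt.2 (le_of_lt ht))) |>.2 hω
    _ = _ := by
        rw [← ofReal_integral_eq_lintegral_ofReal hint]
        · rw [Real.integral_rpow_mul_exp_neg_mul_Ioi hγ hθ0, ← ENNReal.ofReal_mul hγ.le]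
          congr 1
          have : 1 / θ = σ ^ 2 / 2 * (1 / c) := by rw [hθ]; field_simp
          rw [this, Real.mul_rpow (by positivity) (by positivity)]
          ring
        · filter_upwards [self_mem_ae_restrict measurableSet_Ioi] with t ht
          exact mul_nonneg (Real.rpow_nonneg (le_of_lt ht) _) (Real.exp_pos _).le

end Tail

/-! ### Reflection and time reversal of a single path. -/

/-- The path with increments `b t - b (t - s)` reversed from time `t`, continued by `b - b 0`. -/
def reversePath (b : ℝ≥0 → ℝ) (t s : ℝ≥0) : ℝ := b (max s t) - b (t - s)

section Paths

variable {σ c u : ℝ} {b : ℝ≥0 → ℝ} {t : ℝ≥0}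

lemma continuous_drifted (hb : Continuous b) : Continuous (drifted σ c b) :=
  ENNReal.continuous_ofReal.comp (by fun_prop)

lemma continuous_reversePath (hb : Continuous b) (t : ℝ≥0) : Continuous (reversePath b t) := by
  unfold reversePath
  have h : Continuous fun s : ℝ≥0 => t - s := continuous_const.sub continuous_id
  exact (hb.comp (by fun_prop)).sub (hb.comp h)

lemma runSup_le_totSup : runSup σ c b t ≤ totSup σ c b :=
  iSup_le fun r => le_iSup (drifted σ c b) (min r t)

lemma tendsto_runSup : Tendsto (runSup σ c b) atTop (𝓝 (totSup σ c b)) := by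
  have hmono : Monotone (runSup σ c b) := fun s t hst =>
    iSup_le fun r => by
      have h : min r s = min (min r s) t := (min_eq_left ((min_le_right _ _).trans hst)).symm
      rw [h]
      exact le_iSup (fun r => drifted σ c b (min r t)) (min r s)
  have h : ⨆ t, runSup σ c b t = totSup σ c b := by
    refine le_antisymm (iSup_le fun t => runSup_le_totSup) (iSup_le fun r => ?_)
    refine le_trans ?_ (le_iSup _ r)
    have := le_iSup (fun s => drifted σ c b (min s r)) r
    rwa [min_self] at this
  rw [← h]
  exact tendsto_atTop_iSup hmono

lemma totSup_anti {c' : ℝ} (h : c ≤ c') : totSup σ c' b ≤ totSup σ c b :=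
  iSup_mono fun r => ENNReal.ofReal_le_ofReal (by
    have := mul_le_mul_of_nonneg_right h r.coe_nonneg; linarith)

/-- The Skorokhod reflection of a path with drift, as a running supremum of the reversed path. -/
lemma ofReal_skorokhod_eq (hb : Continuous b) :
    ENNReal.ofReal (skorokhod (fun s => u + (σ * b s - c * s)) t) =
      max (runSup σ c (reversePath b t) t) (ENNReal.ofReal (u + (σ * b t - c * t))) := by
  set f : ℝ≥0 → ℝ := fun s => u + (σ * b s - c * s) with hf
  have hfc : Continuous f := by fun_prop
  have hcomp : IsCompact (f '' Set.Icc 0 t) := isCompact_Icc.image hfc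
  have hne : (f '' Set.Icc 0 t).Nonempty := ⟨f 0, 0, ⟨le_rfl, zero_le⟩, rfl⟩
  -- The initial value u cancels in the increment, so it enters the result only through the other
  -- term of the maximum.
  have hterm (r : ℝ≥0) (hr : r ≤ t) :
      drifted σ c (reversePath b t) r = ENNReal.ofReal (f t - f (t - r)) := by
    simp only [drifted, reversePath, hf, max_eq_right hr, NNReal.coe_sub hr]
    congr 1; ring
  have hsk : skorokhod f t = max (f t - sInf (f '' Set.Icc 0 t)) (f t) := by
    unfold skorokhod
    rcases le_total (sInf (f '' Set.Icc 0 t)) 0 with h | h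
    · rw [min_eq_left h, max_eq_left (by linarith)]
    · rw [min_eq_right h, max_eq_right (by linarith), sub_zero]
  rw [hsk, ENNReal.ofReal_max]
  congr 1
  apply le_antisymm
  · obtain ⟨s, hs, hs'⟩ := hcomp.sInf_mem hne
    rw [← hs']
    have := hterm (t - s) tsub_le_self
    rw [tsub_tsub_cancel_of_le hs.2] at this
    rw [← this]
    have h2 := le_iSup (fun r => drifted σ c (reversePath b t) (min r t)) (t - s)
    rwa [min_eq_left tsub_le_self] at h2
  · refine iSup_le fun r => ?_
    rw [hterm _ (min_le_right _ _)]
    refine ENNReal.ofReal_le_ofReal (sub_le_sub_left (csInf_le hcomp.bddBelow ?_) _)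
    exact ⟨_, ⟨zero_le, tsub_le_self⟩, rfl⟩

/-- Reduces suprema over time to countable ones, the source of all measurability below. -/
lemma iSup_eq_iSup_denseSeq {f : ℝ≥0 → ℝ≥0∞} (hf : Continuous f) :
    ⨆ r, f r = ⨆ n : ℕ, f (TopologicalSpace.denseSeq ℝ≥0 n) := by
  refine le_antisymm (iSup_le fun r => ?_) (iSup_le fun n => le_iSup f _)
  refine (TopologicalSpace.denseRange_denseSeq ℝ≥0).induction_on
    (p := fun r => f r ≤ ⨆ n : ℕ, f (TopologicalSpace.denseSeq ℝ≥0 n)) r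
    (isClosed_le hf continuous_const) fun n => le_iSup (fun n => f (TopologicalSpace.denseSeq ℝ≥0 n)) n

lemma runSup_eq_iSup_denseSeq (hb : Continuous b) :
    runSup σ c b t = ⨆ n : ℕ, drifted σ c b (min (TopologicalSpace.denseSeq ℝ≥0 n) t) :=
  iSup_eq_iSup_denseSeq ((continuous_drifted hb).comp (by fun_prop))

lemma totSup_eq_iSup_denseSeq (hb : Continuous b) :
    totSup σ c b = ⨆ n : ℕ, drifted σ c b (TopologicalSpace.denseSeq ℝ≥0 n) :=
  iSup_eq_iSup_denseSeq (continuous_drifted hb)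

/-- A path staying below every positive linear drift beats any drift eventually. -/
lemma eventually_drifted_eq_zero (hc : 0 < c) (h : totSup σ (c / 2) b < ∞) (u : ℝ) :
    ∀ᶠ t : ℝ≥0 in atTop, ENNReal.ofReal (u + (σ * b t - c * t)) = 0 := by
  have hlim : Tendsto (fun t : ℝ≥0 => c / 2 * (t : ℝ)) atTop atTop :=
    (NNReal.tendsto_coe_atTop.2 tendsto_id).const_mul_atTop (by positivity)
  filter_upwards [hlim.eventually_ge_atTop (u + (totSup σ (c / 2) b).toReal)] with t ht
  have h1 : ENNReal.ofReal (σ * b t - c / 2 * t) ≤ totSup σ (c / 2) b :=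
    le_iSup (drifted σ (c / 2) b) t
  have h2 := (ENNReal.ofReal_le_iff_le_toReal h.ne).1 h1
  rw [ENNReal.ofReal_eq_zero]
  linarith

end Paths

/-! ### Invariance of the Brownian law under time reversal. -/

section Law

variable {Ω : Type*} [MeasurableSpace Ω] {P : Measure Ω} {B C : ℝ≥0 → Ω → ℝ}

/-- Finite-dimensional distributions determine the law on the product σ-algebra. -/
lemma lintegral_eq_of_isPreBrownianReal (hB : IsPreBrownianReal B P) (hC : IsPreBrownianReal C P)
    (hBm : ∀ t, Measurable (B t)) (hCm : ∀ t, Measurable (C t))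
    {Φ : (ℝ≥0 → ℝ) → ℝ≥0∞} (hΦ : Measurable Φ) :
    ∫⁻ ω, Φ (fun t => B t ω) ∂P = ∫⁻ ω, Φ (fun t => C t ω) ∂P := by
  have := hB.isGaussianProcess.isProbabilityMeasure
  have h1 : Measurable fun ω t => B t ω := measurable_pi_lambda _ hBm
  have h2 : Measurable fun ω t => C t ω := measurable_pi_lambda _ hCm
  rw [← lintegral_map hΦ h1, ← lintegral_map hΦ h2,
    (map_eq_iff_forall_finset_map_restrict_eq h1.aemeasurable h2.aemeasurable).2 fun I =>
      (hB.hasLaw I).map_eq.trans (hC.hasLaw I).map_eq.symm]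

/-- The reversed process is linear in B, hence centred Gaussian, and its covariance is computed to
be min(s, r). Truncated subtraction makes t − s vanish for s ≥ t, so one formula covers both sides
of t. -/
lemma isPreBrownianReal_reversePath (hB : IsPreBrownianReal B P) (t : ℝ≥0) :
    IsPreBrownianReal (fun s ω => reversePath (fun r => B r ω) t s) P := by
  have hprob := hB.isGaussianProcess.isProbabilityMeasure
  have h2 (s : ℝ≥0) : MemLp (B s) 2 P := (hB.isGaussianProcess.hasGaussianLaw_eval s).memLp_two
  refine (hB.isGaussianProcess.of_isGaussianProcess ?_).isPreBrownianReal_of_covariance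
    (fun s => ?_) (fun s r hsr => ?_)
  · intro s
    exact ⟨{max s t, t - s},
        { toFun x := x ⟨max s t, by simp⟩ - x ⟨t - s, by simp⟩
          map_add' x y := by simp; abel
          map_smul' c x := by simp; ring }, by simp [reversePath]⟩
  · change ∫ ω, B (max s t) ω - B (t - s) ω ∂P = 0
    rw [integral_sub (hB.integrable_eval _) (hB.integrable_eval _), hB.integral_eval,
      hB.integral_eval, sub_zero]
  · change cov[B (max s t) - B (t - s), B (max r t) - B (t - r); P] = s
    rw [covariance_sub_left (h2 _) (h2 _) ((h2 _).sub (h2 _)),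
      covariance_sub_right (h2 _) (h2 _) (h2 _), covariance_sub_right (h2 _) (h2 _) (h2 _),
      hB.covariance_eval, hB.covariance_eval, hB.covariance_eval, hB.covariance_eval]
    have e1 : min (max s t) (max r t) = max s t := min_eq_left (max_le_max_right t hsr)
    have e2 : min (max s t) (t - r) = t - r :=
      min_eq_right (tsub_le_self.trans (le_max_right _ _))
    have e3 : min (t - s) (max r t) = t - s :=
      min_eq_left (tsub_le_self.trans (le_max_right _ _))
    have e4 : min (t - s) (t - r) = t - r := min_eq_right (tsub_le_tsub_left hsr t)
    rw [e1, e2, e3, e4]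
    rcases le_total s t with h | h
    · rw [max_eq_right h, NNReal.coe_sub h]; ring
    · rw [max_eq_left h, tsub_eq_zero_of_le h]; simp

end Law

/-! ### Joint measurability in drift and path. -/

section Measurability

variable {α Ω : Type*} [MeasurableSpace α] [MeasurableSpace Ω] {σ : ℝ}

lemma measurable_drifted {m : α → ℝ} (hm : Measurable m) (s : ℝ≥0) :
    Measurable fun p : α × (ℝ≥0 → ℝ) => drifted σ (m p.1) p.2 s := by
  unfold drifted
  have h : Measurable fun p : α × (ℝ≥0 → ℝ) => p.2 s := (measurable_pi_apply s).comp measurable_snd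
  have h' : Measurable fun p : α × (ℝ≥0 → ℝ) => m p.1 := hm.comp measurable_fst
  fun_prop

lemma measurable_runSup {m : α → ℝ} (hm : Measurable m) {B : ℝ≥0 → Ω → ℝ}
    (hB : ∀ t, Measurable (B t)) (hc : ∀ ω, Continuous fun t => B t ω) (t : ℝ≥0) :
    Measurable fun p : α × Ω => runSup σ (m p.1) (fun s => B s p.2) t := by
  simp_rw [fun p : α × Ω => runSup_eq_iSup_denseSeq (σ := σ) (c := m p.1) (t := t) (hc p.2)]
  refine Measurable.iSup fun n => (measurable_drifted hm _).comp
    (measurable_fst.prodMk (measurable_pi_lambda _ fun s => (hB s).comp measurable_snd))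

lemma measurable_totSup {m : α → ℝ} (hm : Measurable m) {B : ℝ≥0 → Ω → ℝ}
    (hB : ∀ t, Measurable (B t)) (hc : ∀ ω, Continuous fun t => B t ω) :
    Measurable fun p : α × Ω => totSup σ (m p.1) (fun s => B s p.2) := by
  simp_rw [fun p : α × Ω => totSup_eq_iSup_denseSeq (σ := σ) (c := m p.1) (hc p.2)]
  refine Measurable.iSup fun n => (measurable_drifted hm _).comp
    (measurable_fst.prodMk (measurable_pi_lambda _ fun s => (hB s).comp measurable_snd))

/-- Time reversal: the running suprema of the reversed Brownian motion up to time `t`, jointly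
in all drifts, have the law of the running suprema of the Brownian motion itself. -/
lemma lintegral_runSup_reversePath {P : Measure Ω} {B : ℝ≥0 → Ω → ℝ} (hB : IsPreBrownianReal B P)
    (hBm : ∀ t, Measurable (B t)) (hc : ∀ ω, Continuous fun t => B t ω)
    {m : α → ℝ} (hm : Measurable m) (ν : Measure α) [SFinite ν] (t : ℝ≥0) (γ : ℝ) :
    ∫⁻ ω, (∫⁻ x, runSup σ (m x) (reversePath (fun s => B s ω) t) t ∂ν) ^ γ ∂P =
      ∫⁻ ω, (∫⁻ x, runSup σ (m x) (fun s => B s ω) t ∂ν) ^ γ ∂P := by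
  -- Continuity of a path is not an event of the product σ-algebra; the countable supremum is a
  -- functional measurable on all of path space, which the comparison of laws requires.
  simp_rw [fun x ω => runSup_eq_iSup_denseSeq (σ := σ) (c := m x) (t := t) (hc ω),
    fun x ω => runSup_eq_iSup_denseSeq (σ := σ) (c := m x) (t := t)
      (continuous_reversePath (hc ω) t)]
  refine lintegral_eq_of_isPreBrownianReal (isPreBrownianReal_reversePath hB t) hB
    (fun s => (hBm _).sub (hBm _)) hBm (Φ := fun b =>
      (∫⁻ x, ⨆ n : ℕ, drifted σ (m x) b (min (TopologicalSpace.denseSeq ℝ≥0 n) t) ∂ν) ^ γ) ?_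
  refine Measurable.pow_const (Measurable.lintegral_prod_left ?_) _
  exact Measurable.iSup fun n => measurable_drifted hm _

end Measurability

/-! ### A squeeze in L^γ. -/

section Moments

variable {α Ω : Type*} [MeasurableSpace α] [MeasurableSpace Ω] {P : Measure Ω} {γ : ℝ} {ν : Measure α}

lemma lintegral_max_le_add {f : α → ℝ≥0∞} (hf : Measurable f) (g : α → ℝ≥0∞) :
    ∫⁻ x, max (f x) (g x) ∂ν ≤ ∫⁻ x, f x ∂ν + ∫⁻ x, g x ∂ν := by
  rw [← lintegral_add_left hf]
  exact lintegral_mono fun x => max_le_add_of_nonneg zero_le zero_le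

/-- Minkowski: ‖V‖ ≤ ‖F‖ ≤ ‖V‖ + ‖R‖ in L^γ, and ‖R‖ tends to 0. -/
lemma tendsto_lintegral_rpow_of_le_of_le_add {ι : Type*} {l : Filter ι} (hγ : 1 ≤ γ)
    {V R F : ι → Ω → ℝ≥0∞} (hVm : ∀ t, Measurable (V t)) (hRm : ∀ t, Measurable (R t))
    (hVF : ∀ t ω, V t ω ≤ F t ω) (hFVR : ∀ t ω, F t ω ≤ V t ω + R t ω)
    (hV : ∀ t, ∫⁻ ω, V t ω ^ γ ∂P < ∞) (hR : ∀ t, ∫⁻ ω, R t ω ^ γ ∂P < ∞) {S : ℝ≥0∞}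
    (hVlim : Tendsto (fun t => ∫⁻ ω, V t ω ^ γ ∂P) l (𝓝 S))
    (hRlim : Tendsto (fun t => ∫⁻ ω, R t ω ^ γ ∂P) l (𝓝 0)) :
    (∀ t, ∫⁻ ω, F t ω ^ γ ∂P < ∞) ∧ Tendsto (fun t => ∫⁻ ω, F t ω ^ γ ∂P) l (𝓝 S) := by
  have hγ0 : 0 < γ := by linarith
  refine ⟨fun t => (lintegral_mono fun ω => ENNReal.rpow_le_rpow (hFVR t ω) hγ0.le).trans_lt
    (ENNReal.lintegral_rpow_add_lt_top_of_lintegral_rpow_lt_top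
      (hVm t).aemeasurable (hV t) (hR t) hγ), ?_⟩
  have hroot : Tendsto (fun t => (∫⁻ ω, F t ω ^ γ ∂P) ^ (1 / γ)) l (𝓝 (S ^ (1 / γ))) := by
    refine tendsto_of_tendsto_of_tendsto_of_le_of_le (hVlim.ennrpow_const (1 / γ))
      (h := fun t => (∫⁻ ω, V t ω ^ γ ∂P) ^ (1 / γ) + (∫⁻ ω, R t ω ^ γ ∂P) ^ (1 / γ)) ?_
      (fun t => ?_) (fun t => ?_)
    · have h := (hVlim.ennrpow_const (1 / γ)).add (hRlim.ennrpow_const (1 / γ))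
      rwa [ENNReal.zero_rpow_of_pos (by positivity), add_zero] at h
    · exact ENNReal.rpow_le_rpow (lintegral_mono fun ω =>
        ENNReal.rpow_le_rpow (hVF t ω) hγ0.le) (by positivity)
    · refine le_trans (ENNReal.rpow_le_rpow (lintegral_mono fun ω =>
        ENNReal.rpow_le_rpow (hFVR t ω) hγ0.le) (by positivity)) ?_
      exact ENNReal.lintegral_Lp_add_le (hVm t).aemeasurable (hRm t).aemeasurable hγ
  have h := hroot.ennrpow_const γ
  simpa only [← ENNReal.rpow_mul, one_div_mul_cancel hγ0.ne', ENNReal.rpow_one] using h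

end Moments

/-! ### Convergence for a general family of drifts. -/

section Convergence

variable {α Ω : Type*} [MeasurableSpace α] [MeasurableSpace Ω] {P : Measure Ω}
  {B : ℝ≥0 → Ω → ℝ} {σ γ : ℝ} {ν : Measure α} [SFinite ν] {m : α → ℝ}

/-- Dominated convergence twice, over the drifts and then over Ω, with the all-time supremum as the
dominating function. -/
lemma tendsto_lintegral_runSup_rpow (hBm : ∀ t, Measurable (B t))
    (hBc : ∀ ω, Continuous fun t => B t ω) (hγ : 0 < γ) (hm : Measurable m)
    (hS : ∫⁻ ω, (∫⁻ x, totSup σ (m x) (fun s => B s ω) ∂ν) ^ γ ∂P < ∞) :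
    Tendsto (fun t => ∫⁻ ω, (∫⁻ x, runSup σ (m x) (fun s => B s ω) t ∂ν) ^ γ ∂P) atTop
      (𝓝 (∫⁻ ω, (∫⁻ x, totSup σ (m x) (fun s => B s ω) ∂ν) ^ γ ∂P)) := by
  have hSm : Measurable fun ω => ∫⁻ x, totSup σ (m x) (fun s => B s ω) ∂ν :=
    (measurable_totSup hm hBm hBc).lintegral_prod_left
  have hfin := ae_lt_top (hSm.pow_const γ) hS.ne
  refine tendsto_lintegral_filter_of_dominated_convergence _
    (Eventually.of_forall fun t => ?_) (Eventually.of_forall fun t => Eventually.of_forall fun ω => ?_)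
    hS.ne ?_
  · exact (measurable_runSup hm hBm hBc t).lintegral_prod_left.pow_const γ
  · exact ENNReal.rpow_le_rpow (lintegral_mono fun x => runSup_le_totSup) hγ.le
  · filter_upwards [hfin] with ω hω
    refine Tendsto.ennrpow_const γ ?_
    refine tendsto_lintegral_filter_of_dominated_convergence _
      (Eventually.of_forall fun t => ?_)
      (Eventually.of_forall fun t => Eventually.of_forall fun x => runSup_le_totSup)
      ((ENNReal.rpow_lt_top_iff_of_pos hγ).1 hω).ne (Eventually.of_forall fun x => tendsto_runSup)
    exact (measurable_runSup hm hBm hBc t).comp measurable_prodMk_right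

lemma ofReal_add_drift_le (u : ℝ≥0) (c : ℝ) (b : ℝ≥0 → ℝ) (t : ℝ≥0) :
    ENNReal.ofReal (u + (σ * b t - c * t)) ≤ u + totSup σ c b :=
  ENNReal.ofReal_add_le.trans (add_le_add (by simp) (le_iSup (drifted σ c b) t))

lemma measurable_ofReal_add_drift {u : α → Ω → ℝ≥0} (hu : Measurable fun p : α × Ω => u p.1 p.2)
    (hBm : ∀ t, Measurable (B t)) (hm : Measurable m) (t : ℝ≥0) :
    Measurable fun p : α × Ω => ENNReal.ofReal (u p.1 p.2 + (σ * B t p.2 - m p.1 * t)) := by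
  have h1 : Measurable fun p : α × Ω => B t p.2 := (hBm t).comp measurable_snd
  have h2 : Measurable fun p : α × Ω => m p.1 := hm.comp measurable_fst
  fun_prop

variable [IsProbabilityMeasure P]

/-- This is the term that remembers the initial condition. For each drift it is eventually 0, almost
surely, and it stays below u plus the all-time supremum. -/
lemma tendsto_lintegral_drift_rpow (hB : IsPreBrownianReal B P) (hBm : ∀ t, Measurable (B t))
    (hBc : ∀ ω, Continuous fun t => B t ω) (hσ : 0 < σ) (hγ : 1 ≤ γ) (hm : Measurable m)
    (hpos : ∀ x, 0 < m x) {u : α → Ω → ℝ≥0} (hu : Measurable fun p : α × Ω => u p.1 p.2)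
    (hU : ∫⁻ ω, (∫⁻ x, (u x ω : ℝ≥0∞) ∂ν) ^ γ ∂P < ∞)
    (hS : ∫⁻ ω, (∫⁻ x, totSup σ (m x) (fun s => B s ω) ∂ν) ^ γ ∂P < ∞) :
    (∀ t, ∫⁻ ω, (∫⁻ x, ENNReal.ofReal (u x ω + (σ * B t ω - m x * t)) ∂ν) ^ γ ∂P < ∞) ∧
    Tendsto (fun t => ∫⁻ ω, (∫⁻ x, ENNReal.ofReal (u x ω + (σ * B t ω - m x * t)) ∂ν) ^ γ ∂P)
      atTop (𝓝 0) := by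
  have hγ0 : 0 < γ := by linarith
  have hum : Measurable fun p : α × Ω => (u p.1 p.2 : ℝ≥0∞) := hu.coe_nnreal_ennreal
  have hUm : Measurable fun ω => ∫⁻ x, (u x ω : ℝ≥0∞) ∂ν := hum.lintegral_prod_left
  have hSm : Measurable fun ω => ∫⁻ x, totSup σ (m x) (fun s => B s ω) ∂ν :=
    (measurable_totSup hm hBm hBc).lintegral_prod_left
  have hsum : ∫⁻ ω, (∫⁻ x, ((u x ω : ℝ≥0∞) + totSup σ (m x) (fun s => B s ω)) ∂ν) ^ γ ∂P < ∞ := by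
    have h := ENNReal.lintegral_rpow_add_lt_top_of_lintegral_rpow_lt_top
      (hUm.aemeasurable (μ := P)) hU hS hγ
    refine lt_of_eq_of_lt (lintegral_congr fun ω => ?_) h
    have hx : Measurable fun x => (u x ω : ℝ≥0∞) := hum.comp measurable_prodMk_right
    rw [Pi.add_apply, lintegral_add_left hx]
  have hle (t : ℝ≥0) (ω : Ω) : (∫⁻ x, ENNReal.ofReal (u x ω + (σ * B t ω - m x * t)) ∂ν) ^ γ ≤
      (∫⁻ x, ((u x ω : ℝ≥0∞) + totSup σ (m x) (fun s => B s ω)) ∂ν) ^ γ :=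
    ENNReal.rpow_le_rpow
      (lintegral_mono fun x => ofReal_add_drift_le (u x ω) (m x) (fun s => B s ω) t) hγ0.le
  refine ⟨fun t => (lintegral_mono (hle t)).trans_lt hsum, ?_⟩
  -- One null set must serve every x. The supremum decreases in the drift, so countably many drifts
  -- 1/(n+1) suffice.
  have hdown : ∀ᵐ ω ∂P, ∀ n : ℕ, totSup σ (1 / ((n : ℝ) + 1)) (fun s => B s ω) < ∞ :=
    ae_all_iff.2 fun n => ae_totSup_lt_top hBm hB hBc hσ (by positivity)
  have hsm : Measurable fun ω => ∫⁻ x, ((u x ω : ℝ≥0∞) + totSup σ (m x) (fun s => B s ω)) ∂ν :=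
    (hum.add (measurable_totSup hm hBm hBc)).lintegral_prod_left
  have hfin := ae_lt_top (hsm.pow_const γ) hsum.ne
  rw [← lintegral_zero (μ := P)]
  refine tendsto_lintegral_filter_of_dominated_convergence _
    (Eventually.of_forall fun t => ?_) (Eventually.of_forall fun t =>
      Eventually.of_forall fun ω => hle t ω) hsum.ne ?_
  · exact (measurable_ofReal_add_drift hu hBm hm t).lintegral_prod_left.pow_const γ
  · filter_upwards [hfin, hdown] with ω hω hd
    have h0 : Tendsto (fun t => ∫⁻ x, ENNReal.ofReal (u x ω + (σ * B t ω - m x * t)) ∂ν) atTop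
        (𝓝 (∫⁻ _, 0 ∂ν)) := by
      refine tendsto_lintegral_filter_of_dominated_convergence _
        (Eventually.of_forall fun t => ?_) (Eventually.of_forall fun t => Eventually.of_forall fun x =>
          ofReal_add_drift_le (u x ω) (m x) (fun s => B s ω) t)
        ((ENNReal.rpow_lt_top_iff_of_pos hγ0).1 hω).ne (Eventually.of_forall fun x => ?_)
      · exact (measurable_ofReal_add_drift hu hBm hm t).comp measurable_prodMk_right
      · obtain ⟨n, hn⟩ := exists_nat_one_div_lt (half_pos (hpos x))
        have hlt : totSup σ (m x / 2) (fun s => B s ω) < ∞ := (totSup_anti hn.le).trans_lt (hd n)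
        exact tendsto_const_nhds.congr'
          ((eventually_drifted_eq_zero (hpos x) hlt (u x ω)).mono fun t ht => ht.symm)
    have h1 := h0.ennrpow_const γ
    rwa [lintegral_zero, ENNReal.zero_rpow_of_pos hγ0] at h1

/-- Convergence of the moments of an integral, over a family of drifts, of reflected Brownian
motions to those of the integral of the all-time suprema. -/
theorem tendsto_lintegral_reflected_rpow (hB : IsPreBrownianReal B P)
    (hBm : ∀ t, Measurable (B t))
    (hBc : ∀ ω, Continuous fun t => B t ω) (hσ : 0 < σ) (hγ : 1 ≤ γ) (hm : Measurable m)
    (hpos : ∀ x, 0 < m x) {u : α → Ω → ℝ≥0} (hu : Measurable fun p : α × Ω => u p.1 p.2)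
    (hU : ∫⁻ ω, (∫⁻ x, (u x ω : ℝ≥0∞) ∂ν) ^ γ ∂P < ∞)
    (hS : ∫⁻ ω, (∫⁻ x, totSup σ (m x) (fun s => B s ω) ∂ν) ^ γ ∂P < ∞) :
    (∀ t, ∫⁻ ω, (∫⁻ x, ENNReal.ofReal
      (skorokhod (fun s => u x ω + (σ * B s ω - m x * s)) t) ∂ν) ^ γ ∂P < ∞) ∧
    Tendsto (fun t => ∫⁻ ω, (∫⁻ x, ENNReal.ofReal
      (skorokhod (fun s => u x ω + (σ * B s ω - m x * s)) t) ∂ν) ^ γ ∂P) atTop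
      (𝓝 (∫⁻ ω, (∫⁻ x, totSup σ (m x) (fun s => B s ω) ∂ν) ^ γ ∂P)) := by
  have hγ0 : 0 < γ := by linarith
  simp_rw [fun x ω t => ofReal_skorokhod_eq (σ := σ) (c := m x) (u := u x ω) (t := t) (hBc ω)]
  obtain ⟨hRfin, hRlim⟩ := tendsto_lintegral_drift_rpow hB hBm hBc hσ hγ hm hpos hu hU hS
  have hVlim := tendsto_lintegral_runSup_rpow hBm hBc hγ0 hm hS
  -- The reversed path changes with t, so its supremum need not converge pathwise; only the moments
  -- are transferred, by equality in law.
  have hVeq := lintegral_runSup_reversePath (σ := σ) hB hBm hBc hm ν (γ := γ)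
  have hvm (t : ℝ≥0) : Measurable fun p : α × Ω =>
      runSup σ (m p.1) (reversePath (fun s => B s p.2) t) t :=
    measurable_runSup hm (B := fun s ω => reversePath (fun r => B r ω) t s)
      (fun s => (hBm _).sub (hBm _)) (fun ω => continuous_reversePath (hBc ω) t) t
  refine tendsto_lintegral_rpow_of_le_of_le_add hγ (fun t => (hvm t).lintegral_prod_left)
    (fun t => (measurable_ofReal_add_drift hu hBm hm t).lintegral_prod_left)
    (fun t ω => lintegral_mono fun x => le_max_left _ _)
    (fun t ω => lintegral_max_le_add ((hvm t).comp measurable_prodMk_right) _)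
    (fun t => ?_) hRfin (hVlim.congr fun t => (hVeq t).symm) hRlim
  refine (hVeq t).trans_lt ?_
  exact (lintegral_mono fun ω => ENNReal.rpow_le_rpow
    (lintegral_mono fun x => runSup_le_totSup) hγ0.le).trans_lt hS


end Convergence

/-! ### Continuous versions, extended drift and initial condition. -/

/-- A process with almost surely continuous paths coincides almost surely, at all times, with a
measurable process all of whose paths are continuous. -/
lemma exists_measurable_continuous_version {Ω E : Type*} [MeasurableSpace Ω] {P : Measure Ω}
    [TopologicalSpace E] [TopologicalSpace.PseudoMetrizableSpace E] [MeasurableSpace E]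
    [BorelSpace E] [Zero E] {B : ℝ≥0 → Ω → E} (hm : ∀ t, AEMeasurable (B t) P)
    (hc : ∀ᵐ ω ∂P, Continuous fun t => B t ω) :
    ∃ C : ℝ≥0 → Ω → E, (∀ t, Measurable (C t)) ∧ (∀ ω, Continuous fun t => C t ω) ∧
      ∀ᵐ ω ∂P, ∀ t, B t ω = C t ω := by
  classical
  set d := TopologicalSpace.denseSeq ℝ≥0
  have hgood : ∀ᵐ ω ∂P, Continuous (fun t => B t ω) ∧ ∀ n, B (d n) ω = (hm (d n)).mk _ ω :=
    hc.and (ae_all_iff.2 fun n => (hm (d n)).ae_eq_mk)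
  -- The set of discontinuous paths need not be measurable, so a measurable null set containing it
  -- is used.
  obtain ⟨N, hN, hNm, hN0⟩ := exists_measurable_superset_of_null (ae_iff.1 hgood)
  have hN' (ω : Ω) (hω : ω ∉ N) :
      Continuous (fun t => B t ω) ∧ ∀ n, B (d n) ω = (hm (d n)).mk _ ω := by
    by_contra h; exact hω (hN h)
  set C : ℝ≥0 → Ω → E := fun t ω => if ω ∈ N then 0 else B t ω with hC
  have hcont (ω : Ω) : Continuous fun t => C t ω := by
    by_cases hω : ω ∈ N
    · simpa [hC, hω] using continuous_const
    · simpa [hC, hω] using (hN' ω hω).1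
  have hd (n : ℕ) : Measurable (C (d n)) := by
    have h : C (d n) = fun ω => if ω ∈ N then 0 else (hm (d n)).mk _ ω := by
      funext ω
      by_cases hω : ω ∈ N
      · simp [hC, hω]
      · simp [hC, hω, (hN' ω hω).2 n]
    rw [h]
    exact Measurable.ite hNm measurable_const (hm (d n)).measurable_mk
  refine ⟨C, fun t => ?_, hcont, ?_⟩
  · obtain ⟨s, hs, hst⟩ := mem_closure_iff_seq_limit.1
      (TopologicalSpace.denseRange_denseSeq ℝ≥0 t)
    refine measurable_of_tendsto_metrizable (f := fun n => C (s n)) (fun n => ?_)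
      (tendsto_pi_nhds.2 fun ω => ((hcont ω).tendsto t).comp hst)
    obtain ⟨k, hk⟩ := hs n
    rw [← hk]; exact hd k
  · filter_upwards [measure_eq_zero_iff_ae_notMem.1 hN0] with ω hω t
    simp [hC, hω]

section Drift

variable {μ : ℝ → ℝ}

lemma driftExt_of_pos {a : ℝ≥0∞} (h0 : a ≠ 0) (ht : a ≠ ∞) :
    driftExt μ a = ENNReal.ofReal (μ a.toReal) := by
  simp [driftExt, h0, ht]

lemma driftExt_ne_top (hμ : IsDrift μ) {a : ℝ≥0∞} (h0 : a ≠ 0) : driftExt μ a ≠ ∞ := by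
  by_cases ht : a = ∞
  · subst ht
    -- The truncation at 1 avoids the arbitrary values of μ on (−∞, 0].
    have hanti : Antitone fun b : ℝ => ENNReal.ofReal (μ (max b 1)) := fun b c hbc =>
      ENNReal.ofReal_le_ofReal (hμ.strictAnti.antitoneOn
        (Set.mem_Ioi.2 (by positivity)) (Set.mem_Ioi.2 (by positivity)) (max_le_max_right 1 hbc))
    have hlim : Tendsto (fun b : ℝ => ENNReal.ofReal (μ b)) atTop
        (𝓝 (⨅ b : ℝ, ENNReal.ofReal (μ (max b 1)))) := by
      refine (tendsto_atTop_iInf hanti).congr' ?_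
      filter_upwards [eventually_ge_atTop 1] with b hb
      rw [max_eq_left hb]
    simp only [driftExt, if_true]
    rw [hlim.limUnder_eq]
    exact ((iInf_le (fun b : ℝ => ENNReal.ofReal (μ (max b 1))) 1).trans_lt ENNReal.ofReal_lt_top).ne
  · rw [driftExt_of_pos h0 ht]; exact ENNReal.ofReal_ne_top

/-- The value 1 off (0, ∞) keeps the drift positive everywhere; `invSqMeasure` does not charge that
set. -/
lemma IsDrift.measurable_extend (hμ : IsDrift μ) : Measurable fun x => if 0 < x then μ x else 1 := by
  have h := hμ.continuousOn.measurable_piecewise (g := fun _ => (1 : ℝ)) continuousOn_const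
    measurableSet_Ioi
  convert h using 1
  funext x
  simp [Set.piecewise]

end Drift

section Init

variable {Ω : Type*} [MeasurableSpace Ω] {P : Measure Ω} {B : ℝ≥0 → Ω → ℝ} {w : ℝ≥0 → Ω → ℝ≥0}

omit [MeasurableSpace Ω] in
lemma tendsto_initExt_top {ω : Ω} (h : Monotone fun a => w a ω) :
    Tendsto (fun b => (w b ω : ℝ≥0∞)) atTop (𝓝 (initExt w ∞ ω)) := by
  simp only [initExt, if_true]
  exact tendsto_nhds_limUnder ⟨_, tendsto_atTop_iSup (ENNReal.coe_mono.comp h)⟩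

lemma IsInitial.aemeasurable_initExt (hw : IsInitial P B w) (a : ℝ≥0∞) :
    AEMeasurable (initExt w a) P := by
  by_cases ha : a = ∞
  · subst ha
    refine aemeasurable_of_tendsto_metrizable_ae atTop
      (fun b => ((hw.measurable b).coe_nnreal_ennreal).aemeasurable) ?_
    filter_upwards [hw.monotone] with ω hω using tendsto_initExt_top hω
  · have : initExt w a = fun ω => (w a.toNNReal ω : ℝ≥0∞) := by funext ω; simp [initExt, ha]
    rw [this]
    exact (hw.measurable _).coe_nnreal_ennreal.aemeasurable

lemma lintegral_Ioi_one_inv_rpow_lt_top {q : ℝ} (hq : 1 < q) :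
    ∫⁻ x in Set.Ioi (1 : ℝ), (ENNReal.ofReal x)⁻¹ ^ q < ∞ := by
  have h := (integrableOn_Ioi_rpow_of_lt (by linarith : -q < -1) one_pos).lintegral_lt_top
  refine lt_of_eq_of_lt (setLIntegral_congr_fun measurableSet_Ioi fun x hx => ?_) h
  have hx0 : 0 < x := one_pos.trans hx
  rw [← ENNReal.ofReal_inv_of_pos hx0, ENNReal.ofReal_rpow_of_pos (by positivity),
    Real.inv_rpow hx0.le, Real.rpow_neg hx0.le]

/-- On (0, 1] this is an assumption; beyond 1, monotonicity bounds w by w(∞), and x⁻² is integrable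
there. -/
lemma IsInitial.lintegral_lintegral_lt_top [IsProbabilityMeasure P] (hw : IsInitial P B w) :
    ∫⁻ ω, (∫⁻ a in Set.Ioi (0 : ℝ), (w a.toNNReal ω : ℝ≥0∞) / ENNReal.ofReal (a ^ 2)) ∂P < ∞ := by
  set K := ∫⁻ x in Set.Ioi (1 : ℝ), (ENNReal.ofReal x)⁻¹ ^ (2 : ℝ)
  have hK : K < ∞ := lintegral_Ioi_one_inv_rpow_lt_top one_lt_two
  have hle : ∀ᵐ ω ∂P,
      ∫⁻ a in Set.Ioi (0 : ℝ), (w a.toNNReal ω : ℝ≥0∞) / ENNReal.ofReal (a ^ 2) ≤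
      (∫⁻ a in Set.Ioc (0 : ℝ) 1, (w a.toNNReal ω : ℝ≥0∞) / ENNReal.ofReal (a ^ 2)) +
        K * initExt w ∞ ω := by
    filter_upwards [hw.monotone] with ω hω
    rw [← Set.Ioc_union_Ioi_eq_Ioi (zero_le_one' ℝ), lintegral_union measurableSet_Ioi
      (Set.Ioc_disjoint_Ioi le_rfl)]
    gcongr
    rw [← lintegral_mul_const _ (by fun_prop)]
    refine setLIntegral_mono' measurableSet_Ioi fun x hx => ?_
    have hx0 : (0 : ℝ) < x := one_pos.trans hx
    rw [div_eq_mul_inv, mul_comm]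
    gcongr
    · rw [ENNReal.ofReal_pow hx0.le, ENNReal.inv_rpow, ENNReal.rpow_two]
    · exact (ENNReal.coe_mono.comp hω).ge_of_tendsto (tendsto_initExt_top hω) _
  refine (lintegral_mono_ae hle).trans_lt ?_
  rw [lintegral_add_right' _ ((hw.aemeasurable_initExt ∞).const_mul K),
    lintegral_const_mul'' _ (hw.aemeasurable_initExt ∞)]
  exact ENNReal.add_lt_top.2 ⟨hw.integral_lt_top, ENNReal.mul_lt_top hK hw.top_lt_top⟩

end Init

/-! ### Moments of weighted integrals of all-time suprema. -/

section Weighted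

variable {Ω : Type*} [MeasurableSpace Ω] {P : Measure Ω} [IsProbabilityMeasure P]
  {B : ℝ≥0 → Ω → ℝ} {σ γ : ℝ} {α : Type*} [MeasurableSpace α] {ν : Measure α} [SFinite ν]
  {m : α → ℝ} {k g : α → ℝ≥0∞}

/-- Tonelli and the moment bound of order (1 / m x)^γ for each drift. -/
lemma lintegral_lintegral_totSup_rpow_lt_top (hB : IsPreBrownianReal B P)
    (hBm : ∀ t, Measurable (B t)) (hBc : ∀ ω, Continuous fun t => B t ω) (hσ : 0 < σ) (hγ : 0 < γ)
    (hm : Measurable m) (hpos : ∀ x, 0 < m x) (hkm : Measurable k)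
    (hk : ∫⁻ x, k x * ENNReal.ofReal ((1 / m x) ^ γ) ∂ν < ∞) :
    ∫⁻ ω, (∫⁻ x, (totSup σ (m x) fun t => B t ω) ^ γ * k x ∂ν) ∂P < ∞ := by
  have hSm := measurable_totSup (σ := σ) hm hBm hBc
  rw [lintegral_lintegral_swap]
  swap
  · exact ((hSm.comp measurable_swap).pow_const γ |>.mul (hkm.comp measurable_snd)).aemeasurable
  have hx (x : α) : Measurable fun ω => totSup σ (m x) fun t => B t ω :=
    hSm.comp measurable_prodMk_left
  set K := ENNReal.ofReal (γ * (σ ^ 2 / 2) ^ γ * Real.Gamma γ)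
  calc ∫⁻ x, ∫⁻ ω, (totSup σ (m x) fun t => B t ω) ^ γ * k x ∂P ∂ν
      ≤ ∫⁻ x, K * (k x * ENNReal.ofReal ((1 / m x) ^ γ)) ∂ν := by
        refine lintegral_mono fun x => ?_
        rw [lintegral_mul_const _ ((hx x).pow_const γ)]
        refine (mul_le_mul_left (lintegral_totSup_rpow_le hBm hB hBc hσ (hpos x) (hx x) hγ)
          _).trans_eq ?_
        rw [ENNReal.ofReal_mul (by have := Real.Gamma_pos_of_pos hγ; positivity)]
        ring
    _ < ∞ := by
        rw [lintegral_const_mul' _ _ ENNReal.ofReal_ne_top]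
        exact ENNReal.mul_lt_top ENNReal.ofReal_lt_top hk

/-- Hölder in x: the weight is split as k · g, where g is paid for in L^q and k stays with the
supremum in L^γ, so that the previous bound applies with weight k^γ. -/
lemma lintegral_weighted_totSup_rpow_lt_top (hB : IsPreBrownianReal B P)
    (hBm : ∀ t, Measurable (B t)) (hBc : ∀ ω, Continuous fun t => B t ω) (hσ : 0 < σ)
    {q : ℝ} (hq : γ.HolderConjugate q)
    (hm : Measurable m) (hpos : ∀ x, 0 < m x) (hkm : Measurable k) (hgm : Measurable g)
    (hg : ∫⁻ x, g x ^ q ∂ν < ∞)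
    (hk : ∫⁻ x, k x ^ γ * ENNReal.ofReal ((1 / m x) ^ γ) ∂ν < ∞) :
    ∫⁻ ω, (∫⁻ x, (totSup σ (m x) fun t => B t ω) * k x * g x ∂ν) ^ γ ∂P < ∞ := by
  have hγ := hq.pos
  have hSm := measurable_totSup (σ := σ) hm hBm hBc
  have h := lintegral_lintegral_totSup_rpow_lt_top hB hBm hBc hσ hγ hm hpos (hkm.pow_const γ) hk
  set G := (∫⁻ x, g x ^ q ∂ν) ^ (1 / q) with hG
  have hGfin : G ≠ ∞ := (ENNReal.rpow_lt_top_of_nonneg (by have := hq.symm.pos; positivity) hg.ne).ne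
  have hbound (ω : Ω) : (∫⁻ x, (totSup σ (m x) fun t => B t ω) * k x * g x ∂ν) ^ γ ≤
      (∫⁻ x, (totSup σ (m x) fun t => B t ω) ^ γ * k x ^ γ ∂ν) * G ^ γ := by
    have hx : Measurable fun x => totSup σ (m x) fun t => B t ω := hSm.comp measurable_prodMk_right
    have := ENNReal.lintegral_mul_le_Lp_mul_Lq ν hq (hx.mul hkm).aemeasurable hgm.aemeasurable
    refine (ENNReal.rpow_le_rpow this hγ.le).trans_eq ?_
    rw [ENNReal.mul_rpow_of_nonneg _ _ hγ.le, ← ENNReal.rpow_mul, one_div_mul_cancel hγ.ne',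
      ENNReal.rpow_one]
    simp only [Pi.mul_apply, ENNReal.mul_rpow_of_nonneg _ _ hγ.le, hG]
  refine (lintegral_mono hbound).trans_lt ?_
  rw [lintegral_mul_const' _ _ (ENNReal.rpow_ne_top_of_nonneg hγ.le hGfin)]
  exact ENNReal.mul_lt_top h (ENNReal.rpow_lt_top_of_nonneg hγ.le hGfin)

end Weighted

/-! ### Specialization to W and Z. -/

section Main

variable {Ω : Type*} {B : ℝ≥0 → Ω → ℝ} {σ γ : ℝ} {μ : ℝ → ℝ} {w : ℝ≥0 → Ω → ℝ≥0}

lemma W_eq_skorokhod {a : ℝ≥0∞} (ha : a ≠ 0) (t : ℝ≥0) (ω : Ω) :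
    W σ μ B w t a ω = skorokhod (fun s => ((initExt w a ω).toNNReal : ℝ) +
      (σ * B s ω - (driftExt μ a).toReal * s)) t := by
  simp only [W, chi, X, ha, if_false, ENNReal.coe_toNNReal_eq_toReal]

lemma Mstar_eq_totSup {a : ℝ≥0∞} (ha : a ≠ 0) (ω : Ω) :
    Mstar σ μ B a ω = totSup σ (driftExt μ a).toReal (fun s => B s ω) := by
  simp [Mstar, totSup, drifted, X, ha]

lemma initExt_ofReal (x : ℝ) (ω : Ω) : initExt w (ENNReal.ofReal x) ω = w x.toNNReal ω := by
  simp only [initExt, ENNReal.ofReal_ne_top, if_false]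
  rfl

lemma driftExt_ofReal (hμ : IsDrift μ) {x : ℝ} (hx : 0 < x) :
    (driftExt μ (ENNReal.ofReal x)).toReal = μ x := by
  rw [driftExt_of_pos (by simpa using hx) ENNReal.ofReal_ne_top, ENNReal.toReal_ofReal hx.le,
    ENNReal.toReal_ofReal (hμ.pos x hx).le]

lemma skorokhod_zero {f : ℝ≥0 → ℝ} (hf : 0 ≤ f 0) : skorokhod f 0 = f 0 := by
  simp [skorokhod, hf]

lemma skorokhod_const_zero (t : ℝ≥0) : skorokhod (fun _ => 0) t = 0 := by
  have h : (fun _ : ℝ≥0 => (0 : ℝ)) '' Set.Icc 0 t = {0} :=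
    Set.Nonempty.image_const (s := Set.Icc 0 t) ⟨0, le_rfl, zero_le⟩ 0
  simp [skorokhod, h]

/-- The measure `x⁻² dx` on `(0, ∞)`. -/
noncomputable def invSqMeasure : Measure ℝ :=
  (volume.restrict (Set.Ioi 0)).withDensity fun x => (ENNReal.ofReal (x ^ 2))⁻¹

instance : SFinite invSqMeasure := by unfold invSqMeasure; infer_instance

lemma lintegral_invSqMeasure (f : ℝ → ℝ≥0∞) :
    ∫⁻ x, f x ∂invSqMeasure = ∫⁻ x in Set.Ioi (0 : ℝ), f x / ENNReal.ofReal (x ^ 2) := by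
  rw [invSqMeasure, lintegral_withDensity_eq_lintegral_mul_non_measurable _ (by fun_prop)]
  · simp only [Pi.mul_apply, div_eq_mul_inv, mul_comm]
  · filter_upwards [self_mem_ae_restrict measurableSet_Ioi] with x hx
    have hx0 : (0 : ℝ) < x := hx
    exact ENNReal.inv_lt_top.2 (ENNReal.ofReal_pos.2 (by positivity))

lemma Z_eq_lintegral (hμ : IsDrift μ) (t : ℝ≥0) (ω : Ω) :
    Z σ μ B w t ω = ∫⁻ x, ENNReal.ofReal (skorokhod (fun s => (w x.toNNReal ω : ℝ) +
      (σ * B s ω - (if 0 < x then μ x else 1) * s)) t) ∂invSqMeasure := by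
  rw [lintegral_invSqMeasure, Z]
  refine setLIntegral_congr_fun measurableSet_Ioi fun x hx => ?_
  have hx0 : 0 < x := hx
  simp only [W_eq_skorokhod (a := ENNReal.ofReal x) (by simpa using hx0), initExt_ofReal,
    driftExt_ofReal hμ hx0, hx0, if_true, ENNReal.toNNReal_coe]

lemma Zstar_eq_lintegral (hμ : IsDrift μ) (ω : Ω) :
    Zstar σ μ B ω = ∫⁻ x, totSup σ (if 0 < x then μ x else 1) (fun s => B s ω) ∂invSqMeasure := by
  rw [lintegral_invSqMeasure, Zstar]
  refine setLIntegral_congr_fun measurableSet_Ioi fun x hx => ?_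
  have hx0 : 0 < x := hx
  simp only [Mstar_eq_totSup (a := ENNReal.ofReal x) (by simpa using hx0),
    driftExt_ofReal hμ hx0, hx0, if_true]

lemma Z_zero_eq_lintegral (hμ : IsDrift μ) {ω : Ω} (hω : B 0 ω = 0) :
    Z σ μ B w 0 ω = ∫⁻ x, (w x.toNNReal ω : ℝ≥0∞) ∂invSqMeasure := by
  rw [Z_eq_lintegral hμ]
  refine lintegral_congr fun x => ?_
  rw [skorokhod_zero (by simp [hω])]
  simp [hω]

variable [MeasurableSpace Ω] {P : Measure Ω} [IsProbabilityMeasure P]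

/-- Here a = 0 needs separate treatment: the drift is ∞, with `toReal` 0, so the drift formula does
not apply. Both sides vanish, because w(0) = 0 almost surely and X(0) = 0. -/
lemma tendsto_moment_W_zero (hw : IsInitial P B w) (hγ : 1 ≤ γ) :
    (∀ t, ∫⁻ ω, ENNReal.ofReal (W σ μ B w t 0 ω) ^ γ ∂P < ∞) ∧
      ∫⁻ ω, Mstar σ μ B 0 ω ^ γ ∂P < ∞ ∧
      Tendsto (fun t => ∫⁻ ω, ENNReal.ofReal (W σ μ B w t 0 ω) ^ γ ∂P) atTop
        (𝓝 (∫⁻ ω, Mstar σ μ B 0 ω ^ γ ∂P)) := by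
  have hγ0 : 0 < γ := by linarith
  have hW (t : ℝ≥0) : ∫⁻ ω, ENNReal.ofReal (W σ μ B w t 0 ω) ^ γ ∂P = 0 := by
    refine lintegral_eq_zero_of_ae_eq_zero ?_
    filter_upwards [hw.zero] with ω hω
    have h : (fun s => chi σ μ B w s 0 ω) = fun _ => 0 := by
      funext s; simp [chi, X, initExt, hω]
    simp [W, h, skorokhod_const_zero, ENNReal.zero_rpow_of_pos hγ0]
  have hM : ∫⁻ ω, Mstar σ μ B 0 ω ^ γ ∂P = 0 := by
    simp [Mstar, X, ENNReal.zero_rpow_of_pos hγ0]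
  simp only [hW, hM]
  exact ⟨fun _ => ENNReal.zero_lt_top, ENNReal.zero_lt_top, tendsto_const_nhds⟩

omit [IsProbabilityMeasure P] in
lemma exists_isPreBrownianReal_version (hB : IsBrownianReal B P) :
    ∃ C : ℝ≥0 → Ω → ℝ, (∀ t, Measurable (C t)) ∧ (∀ ω, Continuous fun t => C t ω) ∧
      IsPreBrownianReal C P ∧ ∀ᵐ ω ∂P, (fun t => B t ω) = fun t => C t ω := by
  obtain ⟨C, hCm, hCc, hBC⟩ := exists_measurable_continuous_version hB.aemeasurable hB.cont
  refine ⟨C, hCm, hCc, hB.toIsPreBrownianReal.congr fun t => ?_, ?_⟩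
  · filter_upwards [hBC] with ω hω using hω t
  · filter_upwards [hBC] with ω hω using funext hω

/-- Convergence of moments for a single reflected Brownian motion with negative drift. -/
lemma tendsto_moment_W (hB : IsBrownianReal B P) (hσ : 0 < σ) (hμ : IsDrift μ)
    (hw : IsInitial P B w) (hγ : 1 ≤ γ) {a : ℝ≥0∞} (ha : a ≠ 0) (hpos : 0 < driftExt μ a)
    (hwa : ∫⁻ ω, initExt w a ω ^ γ ∂P < ∞) :
    (∀ t, ∫⁻ ω, ENNReal.ofReal (W σ μ B w t a ω) ^ γ ∂P < ∞) ∧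
      ∫⁻ ω, Mstar σ μ B a ω ^ γ ∂P < ∞ ∧
      Tendsto (fun t => ∫⁻ ω, ENNReal.ofReal (W σ μ B w t a ω) ^ γ ∂P) atTop
        (𝓝 (∫⁻ ω, Mstar σ μ B a ω ^ γ ∂P)) := by
  have hγ0 : 0 < γ := by linarith
  obtain ⟨C, hCm, hCc, hC, hBC⟩ := exists_isPreBrownianReal_version hB
  set c := (driftExt μ a).toReal
  have hc : 0 < c := ENNReal.toReal_pos hpos.ne' (driftExt_ne_top hμ ha)
  have hu := hw.aemeasurable_initExt a
  -- `toNNReal` sends ∞ to 0, the same convention as the `toReal` in `chi`, so the two agree even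
  -- where w(∞) = ∞.
  set u : Ω → ℝ≥0 := fun ω => (hu.mk _ ω).toNNReal
  have huw : ∀ᵐ ω ∂P, (initExt w a ω).toNNReal = u ω := by
    filter_upwards [hu.ae_eq_mk] with ω hω
    rw [hω]
  have hS : ∫⁻ ω, totSup σ c (fun s => C s ω) ^ γ ∂P < ∞ :=
    (lintegral_totSup_rpow_le hCm hC hCc hσ hc
      ((measurable_totSup (α := Unit) (m := fun _ => c) measurable_const hCm hCc).comp
        (measurable_prodMk_left (x := ()))) hγ0).trans_lt ENNReal.ofReal_lt_top
  have hU : ∫⁻ ω, (u ω : ℝ≥0∞) ^ γ ∂P < ∞ := by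
    refine (lintegral_mono_ae ?_).trans_lt hwa
    filter_upwards [huw] with ω hω
    rw [← hω]
    exact ENNReal.rpow_le_rpow ENNReal.coe_toNNReal_le_self hγ0.le
  have hum : Measurable u := hu.measurable_mk.ennreal_toNNReal
  have key := tendsto_lintegral_reflected_rpow (α := Unit) (ν := Measure.dirac ()) (m := fun _ => c)
    (u := fun _ ω => u ω) hC hCm hCc hσ hγ measurable_const (fun _ => hc)
    (hum.comp measurable_snd) (by simpa using hU) (by simpa using hS)
  simp only [lintegral_dirac] at key
  have hW (t : ℝ≥0) : ∫⁻ ω, ENNReal.ofReal (W σ μ B w t a ω) ^ γ ∂P =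
      ∫⁻ ω, ENNReal.ofReal (skorokhod (fun s => u ω + (σ * C s ω - c * s)) t) ^ γ ∂P := by
    refine lintegral_congr_ae ?_
    filter_upwards [huw, hBC] with ω h1 h2
    simp only [W_eq_skorokhod ha, h1, fun s => congrFun h2 s, c]
  have hM : ∫⁻ ω, Mstar σ μ B a ω ^ γ ∂P = ∫⁻ ω, totSup σ c (fun s => C s ω) ^ γ ∂P := by
    refine lintegral_congr_ae ?_
    filter_upwards [hBC] with ω h2
    simp only [Mstar_eq_totSup ha, h2, c]
  simp only [hW, hM]
  exact ⟨key.1, hS, key.2⟩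

/-- Convergence of the moments of `Z`, given the moments of the initial value and of the limit. -/
lemma tendsto_moment_Z (hB : IsBrownianReal B P) (hσ : 0 < σ) (hμ : IsDrift μ)
    (hw : IsInitial P B w) (hγ : 1 ≤ γ)
    (hU : ∫⁻ ω, (∫⁻ x, (w x.toNNReal ω : ℝ≥0∞) ∂invSqMeasure) ^ γ ∂P < ∞)
    (hS : ∀ C : ℝ≥0 → Ω → ℝ, (∀ t, Measurable (C t)) → (∀ ω, Continuous fun t => C t ω) →
      IsPreBrownianReal C P → ∫⁻ ω, (∫⁻ x, totSup σ (if 0 < x then μ x else 1)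
        (fun s => C s ω) ∂invSqMeasure) ^ γ ∂P < ∞) :
    (∀ t, ∫⁻ ω, Z σ μ B w t ω ^ γ ∂P < ∞) ∧ ∫⁻ ω, Zstar σ μ B ω ^ γ ∂P < ∞ ∧
      Tendsto (fun t => ∫⁻ ω, Z σ μ B w t ω ^ γ ∂P) atTop (𝓝 (∫⁻ ω, Zstar σ μ B ω ^ γ ∂P)) := by
  obtain ⟨C, hCm, hCc, hC, hBC⟩ := exists_isPreBrownianReal_version hB
  -- Continuity of every path of v makes it jointly measurable in (x, ω).
  obtain ⟨v, hvm, hvc, hwv⟩ := exists_measurable_continuous_version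
    (fun a => (hw.measurable a).aemeasurable) hw.continuous
  have hv : Measurable fun p : ℝ × Ω => v p.1.toNNReal p.2 :=
    (measurable_uncurry_of_continuous_of_measurable (u := v) hvc hvm).comp
      ((measurable_real_toNNReal.comp measurable_fst).prodMk measurable_snd)
  have hm1 (x : ℝ) : 0 < if 0 < x then μ x else 1 := by
    split_ifs with h
    · exact hμ.pos x h
    · exact one_pos
  have hU' : ∫⁻ ω, (∫⁻ x, (v x.toNNReal ω : ℝ≥0∞) ∂invSqMeasure) ^ γ ∂P < ∞ := by
    refine lt_of_eq_of_lt (lintegral_congr_ae ?_) hU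
    filter_upwards [hwv] with ω hω
    simp only [hω]
  have key := tendsto_lintegral_reflected_rpow (u := fun x ω => v x.toNNReal ω) hC hCm hCc hσ hγ
    hμ.measurable_extend hm1 hv hU' (hS C hCm hCc hC)
  have hZ (t : ℝ≥0) : ∫⁻ ω, Z σ μ B w t ω ^ γ ∂P = ∫⁻ ω, (∫⁻ x, ENNReal.ofReal
      (skorokhod (fun s => v x.toNNReal ω + (σ * C s ω - (if 0 < x then μ x else 1) * s)) t)
        ∂invSqMeasure) ^ γ ∂P := by
    refine lintegral_congr_ae ?_
    filter_upwards [hwv, hBC] with ω h1 h2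
    simp only [Z_eq_lintegral hμ, h1, fun s => congrFun h2 s]
  have hM : ∫⁻ ω, Zstar σ μ B ω ^ γ ∂P = ∫⁻ ω, (∫⁻ x, totSup σ (if 0 < x then μ x else 1)
      (fun s => C s ω) ∂invSqMeasure) ^ γ ∂P := by
    refine lintegral_congr_ae ?_
    filter_upwards [hBC] with ω h2
    simp only [Zstar_eq_lintegral hμ, h2]
  simp only [hZ, hM]
  exact ⟨key.1, hS C hCm hCc hC, key.2⟩

lemma lintegral_totSup_invSqMeasure_lt_top {C : ℝ≥0 → Ω → ℝ} (hCm : ∀ t, Measurable (C t))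
    (hCc : ∀ ω, Continuous fun t => C t ω) (hC : IsPreBrownianReal C P) (hσ : 0 < σ)
    (hμ : IsDrift μ) (hint : IntegrableOn (fun x : ℝ => 1 / (x ^ 2 * μ x)) (Set.Ioi 0)) :
    ∫⁻ ω, (∫⁻ x, totSup σ (if 0 < x then μ x else 1) (fun s => C s ω) ∂invSqMeasure) ∂P < ∞ := by
  have hm1 (x : ℝ) : 0 < if 0 < x then μ x else 1 := by
    split_ifs with h
    · exact hμ.pos x h
    · exact one_pos
  have h := lintegral_lintegral_totSup_rpow_lt_top (γ := 1) (ν := invSqMeasure) (k := fun _ => 1)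
    hC hCm hCc hσ one_pos hμ.measurable_extend hm1 measurable_const ?_
  · simpa only [ENNReal.rpow_one, mul_one] using h
  · rw [lintegral_invSqMeasure]
    refine lt_of_eq_of_lt (setLIntegral_congr_fun measurableSet_Ioi fun x hx => ?_)
      hint.lintegral_lt_top
    have hx0 : 0 < x := hx
    have := hμ.pos x hx0
    simp only [hx0, if_true, one_mul, Real.rpow_one]
    rw [← ENNReal.ofReal_div_of_pos (by positivity)]
    congr 1
    field_simp

/-- The weight x⁻² is split for Hölder as x⁻² · 1 on (0, 1], where constants lie in L^q, and as x⁻¹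
· x⁻¹ on (1, ∞), where x^(−q) is integrable since q > 1. Hence the exponents 2γ and γ in the two
assumptions. -/
lemma lintegral_totSup_invSqMeasure_rpow_lt_top {C : ℝ≥0 → Ω → ℝ} (hCm : ∀ t, Measurable (C t))
    (hCc : ∀ ω, Continuous fun t => C t ω) (hC : IsPreBrownianReal C P) (hσ : 0 < σ)
    (hμ : IsDrift μ) (hγ : 1 < γ)
    (hint0 : IntegrableOn (fun x : ℝ => 1 / (x ^ (2 * γ) * μ x ^ γ)) (Set.Ioc 0 1))
    (hint1 : IntegrableOn (fun x : ℝ => 1 / (x ^ γ * μ x ^ γ)) (Set.Ioi 1)) :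
    ∫⁻ ω, (∫⁻ x, totSup σ (if 0 < x then μ x else 1) (fun s => C s ω) ∂invSqMeasure) ^ γ ∂P
      < ∞ := by
  have hm1 (x : ℝ) : 0 < if 0 < x then μ x else 1 := by
    split_ifs with h
    · exact hμ.pos x h
    · exact one_pos
  have hγ0 : 0 < γ := by linarith
  have hq := Real.HolderConjugate.conjExponent hγ
  have hSm := measurable_totSup (σ := σ) hμ.measurable_extend hCm hCc
  have h0 := lintegral_weighted_totSup_rpow_lt_top (ν := volume.restrict (Set.Ioc (0 : ℝ) 1))
    (k := fun x => (ENNReal.ofReal (x ^ 2))⁻¹) (g := fun _ => 1)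
    hC hCm hCc hσ hq hμ.measurable_extend hm1 (by fun_prop) measurable_const (by simp) ?_
  swap
  · refine lt_of_eq_of_lt (setLIntegral_congr_fun measurableSet_Ioc fun x hx => ?_)
      hint0.lintegral_lt_top
    have hx0 : 0 < x := hx.1
    have hμx := hμ.pos x hx0
    simp only [hx0, if_true]
    rw [← ENNReal.ofReal_inv_of_pos (by positivity), ENNReal.ofReal_rpow_of_pos (by positivity),
      ← ENNReal.ofReal_mul (by positivity), Real.rpow_mul hx0.le, Real.rpow_two,
      Real.inv_rpow (by positivity), Real.div_rpow zero_le_one hμx.le, Real.one_rpow]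
    congr 1
    field_simp
  have h1 := lintegral_weighted_totSup_rpow_lt_top (ν := volume.restrict (Set.Ioi (1 : ℝ)))
    (k := fun x => (ENNReal.ofReal x)⁻¹) (g := fun x => (ENNReal.ofReal x)⁻¹)
    hC hCm hCc hσ hq hμ.measurable_extend hm1 (by fun_prop) (by fun_prop)
    (lintegral_Ioi_one_inv_rpow_lt_top hq.symm.lt) ?_
  swap
  · refine lt_of_eq_of_lt (setLIntegral_congr_fun measurableSet_Ioi fun x hx => ?_)
      hint1.lintegral_lt_top
    have hx0 : 0 < x := one_pos.trans hx
    have hμx := hμ.pos x hx0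
    simp only [hx0, if_true]
    rw [← ENNReal.ofReal_inv_of_pos (by positivity), ENNReal.ofReal_rpow_of_pos (by positivity),
      ← ENNReal.ofReal_mul (by positivity),
      Real.inv_rpow (by positivity), Real.div_rpow zero_le_one hμx.le, Real.one_rpow]
    congr 1
    field_simp
  have hk : Measurable fun p : ℝ × Ω => (ENNReal.ofReal (p.1 ^ 2))⁻¹ := by fun_prop
  have hmeas := ((hSm.mul hk).mul (measurable_const (a := 1)))
  have h01 := ENNReal.lintegral_rpow_add_lt_top_of_lintegral_rpow_lt_top
    (Measurable.aemeasurable (μ := P)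
      (Measurable.lintegral_prod_left (μ := volume.restrict (Set.Ioc (0 : ℝ) 1))
        (f := fun x ω => totSup σ (if 0 < x then μ x else 1) (fun s => C s ω) *
          (ENNReal.ofReal (x ^ 2))⁻¹ * 1) hmeas)) h0 h1 hγ.le
  refine lt_of_eq_of_lt (lintegral_congr fun ω => ?_) h01
  rw [lintegral_invSqMeasure, ← Set.Ioc_union_Ioi_eq_Ioi (zero_le_one' ℝ),
    lintegral_union measurableSet_Ioi (Set.Ioc_disjoint_Ioi le_rfl), Pi.add_apply]
  congr 2
  · exact lintegral_congr fun x => by rw [mul_one, div_eq_mul_inv]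
  · refine setLIntegral_congr_fun measurableSet_Ioi fun x hx => ?_
    have hx0 : (0 : ℝ) < x := one_pos.trans hx
    simp only [div_eq_mul_inv, mul_assoc]
    rw [ENNReal.ofReal_pow hx0.le, sq, ENNReal.mul_inv (by simp) (by simp)]

end Main

end RCBM

/-! ### The theorem. -/

theorem theorem2 {Ω : Type*} [MeasurableSpace Ω] (P : Measure Ω) [IsProbabilityMeasure P]
    (B : ℝ≥0 → Ω → ℝ) (hB : IsBrownianReal B P)
    (σ : ℝ) (hσ : 0 < σ) (μ : ℝ → ℝ) (hμ : RCBM.IsDrift μ)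
    (w : ℝ≥0 → Ω → ℝ≥0) (hw : RCBM.IsInitial P B w)
    (γ : ℝ) (hγ : 1 ≤ γ) :
    -- (i)
    (∀ a : ℝ≥0∞, 0 < RCBM.driftExt μ a → ∫⁻ ω, RCBM.initExt w a ω ^ γ ∂P < ∞ →
      (∀ t, ∫⁻ ω, ENNReal.ofReal (RCBM.W σ μ B w t a ω) ^ γ ∂P < ∞) ∧
      ∫⁻ ω, RCBM.Mstar σ μ B a ω ^ γ ∂P < ∞ ∧
      Tendsto (fun t => ∫⁻ ω, ENNReal.ofReal (RCBM.W σ μ B w t a ω) ^ γ ∂P) atTop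
        (𝓝 (∫⁻ ω, RCBM.Mstar σ μ B a ω ^ γ ∂P))) ∧
    -- (ii), first moment
    (IntegrableOn (fun x : ℝ => 1 / (x ^ 2 * μ x)) (Set.Ioi 0) →
      (∀ t, ∫⁻ ω, RCBM.Z σ μ B w t ω ∂P < ∞) ∧
      ∫⁻ ω, RCBM.Zstar σ μ B ω ∂P < ∞ ∧
      Tendsto (fun t => ∫⁻ ω, RCBM.Z σ μ B w t ω ∂P) atTop
        (𝓝 (∫⁻ ω, RCBM.Zstar σ μ B ω ∂P))) ∧
    -- (ii), higher moments
    (1 < γ → ∫⁻ ω, RCBM.Z σ μ B w 0 ω ^ γ ∂P < ∞ →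
      IntegrableOn (fun x : ℝ => 1 / (x ^ (2 * γ) * μ x ^ γ)) (Set.Ioc 0 1) →
      IntegrableOn (fun x : ℝ => 1 / (x ^ γ * μ x ^ γ)) (Set.Ioi 1) →
      (∀ t, ∫⁻ ω, RCBM.Z σ μ B w t ω ^ γ ∂P < ∞) ∧
      ∫⁻ ω, RCBM.Zstar σ μ B ω ^ γ ∂P < ∞ ∧
      Tendsto (fun t => ∫⁻ ω, RCBM.Z σ μ B w t ω ^ γ ∂P) atTop
        (𝓝 (∫⁻ ω, RCBM.Zstar σ μ B ω ^ γ ∂P))) := by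
  refine ⟨fun a ha hwa => ?_, fun hint => ?_, fun hγ1 hZ0 hint0 hint1 => ?_⟩
  · by_cases h0 : a = 0
    · subst h0
      exact RCBM.tendsto_moment_W_zero hw hγ
    · exact RCBM.tendsto_moment_W hB hσ hμ hw hγ h0 ha hwa
  -- The first-moment claim is the exponent 1 case, whatever the given γ.
  · have h := RCBM.tendsto_moment_Z (γ := 1) hB hσ hμ hw le_rfl ?_ fun C hCm hCc hC => ?_
    · simpa only [ENNReal.rpow_one] using h
    · simpa only [ENNReal.rpow_one, RCBM.lintegral_invSqMeasure] using hw.lintegral_lintegral_lt_top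
    · simpa only [ENNReal.rpow_one] using
        RCBM.lintegral_totSup_invSqMeasure_lt_top hCm hCc hC hσ hμ hint
  · refine RCBM.tendsto_moment_Z hB hσ hμ hw hγ ?_ fun C hCm hCc hC =>
      RCBM.lintegral_totSup_invSqMeasure_rpow_lt_top hCm hCc hC hσ hμ hγ1 hint0 hint1
    -- Since B_0 = 0 almost surely, the initial value of Z is the integral of w(x)/x².
    refine lt_of_eq_of_lt (lintegral_congr_ae ?_) hZ0
    filter_upwards [hB.eval_zero_ae_eq_zero] with ω hω
    rw [RCBM.Z_zero_eq_lintegral hμ hω]
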